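/- **Setting.** Let $1\le k\le r-1$ with $k\mid (r-1)$, let $r\le m$, $N=2^m$ and $p\in(0,\tfrac12)$. For $j\ge 0$ put $N^{(j)}=N/2^{j}$ and $p^{(j)}=\tfrac12\bigl(1-(1-2p)^{2^{j}}\bigr)$; put $\overline\eta(q)=\tfrac12(1-2q)$ and $n_{k,m}=\prod_{i=0}^{k-1}\frac{2^m-2^i}{2^k-2^i}$. For $\mathbf y\in\{0,1\}^{2^{M}}$ (coordinates indexed by $\{0,1\}^{M}$) and a $k$-dimensional subspace $\mathbb B\subseteq\{0,1\}^{M}$, the projection $\mathbf y_{/\mathbb B}$ has, for every coset $T$ of $\mathbb B$, the coordinate $\bigoplus_{\mathbf x\in T}y_{\mathbf x}$; labelling the cosets by $\{0,1\}^{M-k}$ through a linear isomorphism $\{0,1\}^{M}/\mathbb B\cong\{0,1\}^{M-k}$, one regards it as a word of length $2^{M-k}$. The all-zeros codeword of $\mathrm{RM}(m,r)$ is sent over the binary symmetric channel with crossover probability $p$, so that the received vector $\mathbf Y$ has $N$ i.i.d. $\mathrm{Ber}(p)$ coordinates. Consider any node at level $\frac{r-1-k}{k}$ of the projection-aggregation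 tree of the RPA (recursive projection-aggregation) decoder, that is, any sequence of $k$-dimensional subspaces $\mathbb S^{(1)},\dots,\mathbb S^{((r-1-k)/k)}$ with $\mathbb S^{(j)}\subseteq\{0,1\}^{m-k(j-1)}$, and let $\tilde{\mathbf Y}\in\{0,1\}^{N^{(r-k-1)}}$ be the vector obtained from $\mathbf Y$ by projecting successively along this sequence. Write $M=m-(r-1-k)$; the code at the node is $\mathrm{RM}(M,k+1)$. One iteration of the decoder at this node decodes each projection $\tilde{\mathbf Y}_{/\mathbb B}$, for $\mathbb B$ a $k$-dimensional subspace of $\{0,1\}^M$, to a codeword $\widehat{\mathbf Y}_{/\mathbb B}$ with a maximum likelihood decoder of $\mathrm{RM}(m-r+1,1)$ (a nearest codeword in Hamming distance, ties broken arbitrarily), and then aggregates: $\overline{\mathbf Y}$ is obtained from $\tilde{\mathbf Y}$ by flipping exactly those coordinates $\mathbf x\in\{0,1\}^M$ for which $\tilde{\mathbf Y}_{/\mathbb B}$ and $\widehat{\mathbf Y}_{/\mathbb B}$ differ at the coset $\mathbf x+\mathbb B$ for more than half of the $k$-dimensional subspaces $\mathbb B$ of $\{0,1\}^M$. **Theorem.**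 For every $0<\epsilon<\overline\eta\bigl(p^{(r-1)}\bigr)$, $$1-\Pr[\overline{\mathbf Y}=\mathbf 0]\;\le\; 32\,n_{k,m}\,\bigl(N^{(r-k-1)}\bigr)^2\exp\!\left(-\ln\!\left(\frac{1-p^{(r-k-1)}}{p^{(r-k-1)}}\right)2^{-2k-2}\,N^{(r-k-1)}\,\epsilon^2\right).$$ -/

import Mathlib

open MeasureTheory ProbabilityTheory

noncomputable section

namespace RPA

/-- The index set `{0,1}^m`, as a vector space over the field with two elements. -/
abbrev Cube (m : ℕ) : Type := Fin m → ZMod 2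

/-- Binary words of length `2^m`, with coordinates indexed by `{0,1}^m`. -/
abbrev Word (m : ℕ) : Type := Cube m → ZMod 2

/-- The Reed-Muller code `RM(m, r)`: evaluation vectors of polynomials of degree at most `r`. -/
def reedMuller (m r : ℕ) : Set (Word m) :=
  {c | ∃ f : MvPolynomial (Fin m) (ZMod 2),
    f.totalDegree ≤ r ∧ ∀ z : Cube m, c z = MvPolynomial.eval z f}

/-- `D` is a maximum likelihood decoder of the code `C` over a binary symmetric channel with
crossover probability below one half: it returns a codeword at minimum Hamming distance
(ties may be broken in any way). -/
def IsMLDecoder {m : ℕ} (C : Set (Word m)) (D : Word m → Word m) : Prop :=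
  ∀ y : Word m, D y ∈ C ∧ ∀ c ∈ C, hammingDist y (D y) ≤ hammingDist y c

/-- The `k`-dimensional subspaces of `{0,1}^m`. -/
abbrev Subspace (k m : ℕ) : Type :=
  {B : Submodule (ZMod 2) (Cube m) // Module.finrank (ZMod 2) B = k}

/-- A labelling of the cosets of `B` by the points of `{0,1}^(m-k)`. It is linear, so that it
carries projections of Reed-Muller codewords to Reed-Muller codewords. -/
abbrev CosetLabelling {k m : ℕ} (B : Subspace k m) : Type :=
  (Cube m ⧸ B.1) ≃ₗ[ZMod 2] Cube (m - k)

/-- The projection of `y` onto the cosets of `B`: the coordinate at a coset `T` is the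
modulo-2 sum of the coordinates of `y` in `T`. -/
def proj {k m : ℕ} (B : Subspace k m) (y : Word m) : (Cube m ⧸ B.1) → ZMod 2 := by
  classical
  exact fun T => ∑ x : Cube m with B.1.mkQ x = T, y x

/-- The projection of `y` as a word of length `2^(m-k)`. -/
def projWord {k m : ℕ} (B : Subspace k m) (e : CosetLabelling B) (y : Word m) : Word (m - k) :=
  fun z => proj B y (e.symm z)

/-- The number `φ(x)` of subspaces `B` for which `y` and the estimates `yhat` disagree
about the projection onto the coset `x + B`. -/
def disagreements {k m : ℕ} (y : Word m)
    (yhat : ∀ B : Subspace k m, (Cube m ⧸ B.1) → ZMod 2) (x : Cube m) : ℕ :=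
  Nat.card {B : Subspace k m // proj B y (B.1.mkQ x) ≠ yhat B (B.1.mkQ x)}

/-- The aggregation subroutine: the coordinate at `x` is flipped if and only if `φ(x)` is more
than half of the number of `k`-dimensional subspaces. -/
def aggregate {k m : ℕ} (y : Word m)
    (yhat : ∀ B : Subspace k m, (Cube m ⧸ B.1) → ZMod 2) : Word m := by
  classical
  exact fun x => y x +
    if (Nat.card (Subspace k m) : ℝ) / 2 < (disagreements y yhat x : ℝ) then 1 else 0

/-- One iteration of the decoder for a code `RM(m, k+1)`: every projection onto the cosets of a
`k`-dimensional subspace is decoded with the decoder `D` for first-order codes of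
length `2^(m-k)`, and the results are aggregated. -/
def rpaIteration {k m : ℕ} (e : ∀ B : Subspace k m, CosetLabelling B)
    (D : Word (m - k) → Word (m - k)) (y : Word m) : Word m :=
  aggregate y fun B T => D (projWord B (e B) y) (e B T)

/-- `ProjPath k m t M`: a path `S⁽¹⁾, …, S⁽ᵗ⁾` from the root of the projection-aggregation tree
for length `2^m` to a node at level `t`, whose words have length `2^M`. Here `S⁽ʲ⁾` is a
`k`-dimensional subspace of `{0,1}^(m-k(j-1))`, given with a labelling of its cosets. -/
inductive ProjPath (k : ℕ) : ℕ → ℕ → ℕ → Type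
  | nil (m : ℕ) : ProjPath k m 0 m
  | cons {m t M : ℕ} (S : Subspace k m) (e : CosetLabelling S)
      (rest : ProjPath k (m - k) t M) : ProjPath k m (t + 1) M

/-- The iterated projection of `y` along a path. -/
def ProjPath.project {k : ℕ} : {m t M : ℕ} → ProjPath k m t M → Word m → Word M
  | _, _, _, .nil _, y => y
  | _, _, _, .cons S e rest, y => rest.project (projWord S e y)

/-- The law of the received vector when the all-zeros codeword is sent over the binary symmetric
channel with crossover probability `p`: independent coordinates, each equal to `1` with
probability `p` and to `0` with probability `1 - p`. -/
def receivedLaw (m : ℕ) (p : unitInterval) : Measure (Word m) :=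
  Measure.pi fun _ : Cube m => bernoulliMeasure (1 : ZMod 2) 0 p

/-- The Gaussian binomial coefficient `n_{k,m}`. -/
def gaussBinom (k m : ℕ) : ℝ :=
  ∏ i ∈ Finset.range k, ((2 : ℝ) ^ m - 2 ^ i) / ((2 : ℝ) ^ k - 2 ^ i)

/-- `p^(j) = (1 - (1 - 2p)^(2^j)) / 2`. -/
def crossover (p : ℝ) (j : ℕ) : ℝ := (1 - (1 - 2 * p) ^ (2 ^ j)) / 2

/-- `η̄(q) = (1 - 2q) / 2`. -/
def etaBar (q : ℝ) : ℝ := (1 - 2 * q) / 2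

/-- `N^(j) = 2^m / 2^j`. -/
def blockLength (m j : ℕ) : ℝ := (2 : ℝ) ^ m / 2 ^ j

end RPA

end

noncomputable section

namespace RPA

/-! A projection adds up disjoint blocks of 2^k independent bits, so a Ber(p) word stays i.i.d. and
1 - 2p becomes (1 - 2p)^(2^k). At the node, with d = r-1-k, the word is therefore i.i.d. with bias q
= p^(d) (`map_project_bitLaw`), and it remains to bound the failure of one iteration.

Put u = 1 - 2q and L = ln((1-q)/q). The iteration succeeds if every projection decodes to 0 and
every majority vote is right; a union bound treats both.

Decoding: nonzero words of RM(n,1) have weight at least 2^(n-1), so a Chernoff bound gives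
`bitLaw_real_decoder_ne_zero_le`. `log_odds_mul_le` converts its exponent, stated at the projected
bias, into one in L.

Voting: if all projections decode to 0, the vote at x is right when `signSum` is positive. That sum
does not involve y x, has mean n·u^(2^k-1) for n subspaces, and changes by at most 2n(2^k-1)/(2^M-1)
when one other bit changes, since every nonzero vector lies in the same fraction of the subspaces. A
bounded differences inequality with variance proxy of order 1/L (`integral_exp_le`) replaces the
usual constant and produces the factor L in the exponent. -/

/-! ### Signs, and characters of independent bits. -/

/-- The sign `(-1)^a` of a bit `a`. -/
def bitSign (a : ZMod 2) : ℝ := if a = 0 then 1 else -1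

@[simp] lemma bitSign_zero : bitSign 0 = 1 := by simp [bitSign]

@[simp] lemma bitSign_one : bitSign 1 = -1 := by simp [bitSign]

lemma zmod_two_eq_zero_or_one (a : ZMod 2) : a = 0 ∨ a = 1 := by
  revert a; decide

lemma bitSign_add (a b : ZMod 2) : bitSign (a + b) = bitSign a * bitSign b := by
  rcases zmod_two_eq_zero_or_one a with rfl | rfl <;>
    rcases zmod_two_eq_zero_or_one b with rfl | rfl <;>
    simp [show (1 : ZMod 2) + 1 = 0 by decide]

lemma bitSign_mul_self (a : ZMod 2) : bitSign a * bitSign a = 1 := by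
  rcases zmod_two_eq_zero_or_one a with rfl | rfl <;> simp

lemma abs_bitSign (a : ZMod 2) : |bitSign a| = 1 := by
  rcases zmod_two_eq_zero_or_one a with rfl | rfl <;> simp

lemma bitSign_sum {ι : Type*} (s : Finset ι) (f : ι → ZMod 2) :
    bitSign (∑ i ∈ s, f i) = ∏ i ∈ s, bitSign (f i) := by
  classical
  induction s using Finset.induction_on with
  | empty => simp
  | insert a s ha ih => rw [Finset.sum_insert ha, Finset.prod_insert ha, bitSign_add, ih]

/-- The law of a family of independent bits, each equal to `1` with probability `p`. -/
def bitLaw (ι : Type*) [Fintype ι] (p : unitInterval) : Measure (ι → ZMod 2) :=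
  Measure.pi fun _ : ι => bernoulliMeasure (1 : ZMod 2) 0 p

section

variable {ι : Type*} [Fintype ι] (p : unitInterval)

instance : IsProbabilityMeasure (bitLaw ι p) := by
  unfold bitLaw; infer_instance

lemma integrable_bitLaw (F : (ι → ZMod 2) → ℝ) : Integrable F (bitLaw ι p) :=
  Integrable.of_finite

lemma integral_bitLaw_prod (f : ι → ZMod 2 → ℝ) :
    ∫ y, ∏ i, f i (y i) ∂(bitLaw ι p) = ∏ i, ((p : ℝ) * f i 1 + (1 - p) * f i 0) := by
  unfold bitLaw
  rw [integral_fintype_prod_eq_prod]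
  simp [integral_bernoulliMeasure]

lemma integral_bitLaw_prod_finset (s : Finset ι) (f : ZMod 2 → ℝ) :
    ∫ y, ∏ i ∈ s, f (y i) ∂(bitLaw ι p) = ((p : ℝ) * f 1 + (1 - p) * f 0) ^ s.card := by
  classical
  have h := integral_bitLaw_prod p (fun (i : ι) a => if i ∈ s then f a else 1)
  have h1 : ∀ i : ι, (p : ℝ) * (if i ∈ s then f 1 else 1) + (1 - p) * (if i ∈ s then f 0 else 1)
      = if i ∈ s then ((p : ℝ) * f 1 + (1 - p) * f 0) else 1 := by
    intro i; split_ifs <;> ring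
  simp only [h1] at h
  simpa [Finset.prod_ite_mem] using h

lemma integral_bitLaw_prod_bitSign (s : Finset ι) :
    ∫ y, ∏ i ∈ s, bitSign (y i) ∂(bitLaw ι p) = (1 - 2 * (p : ℝ)) ^ s.card := by
  rw [integral_bitLaw_prod_finset]; congr 1; simp; ring

/-- The weights p and 1 - p are written in Fourier form, so that the product can be expanded over
characters in `map_fiberSum_bitLaw`. -/
lemma bitLaw_real_singleton (z : ι → ZMod 2) :
    (bitLaw ι p).real {z} = ∏ i, (1 + bitSign (z i) * (1 - 2 * (p : ℝ))) / 2 := by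
  classical
  have h : ∀ y : ι → ZMod 2, ({z} : Set (ι → ZMod 2)).indicator (fun _ => (1 : ℝ)) y
      = ∏ i, (if y i = z i then 1 else 0) := by
    intro y
    by_cases hy : y = z
    · simp [hy]
    · obtain ⟨i, hi⟩ := Function.ne_iff.mp hy
      rw [Set.indicator_of_notMem (by simpa using hy),
        Finset.prod_eq_zero (Finset.mem_univ i) (if_neg hi)]
  have h2 := integral_bitLaw_prod p (fun (i : ι) a => if a = z i then 1 else 0)
  rw [← integral_congr_ae (Filter.Eventually.of_forall h),
    integral_indicator_const _ (measurableSet_singleton z)] at h2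
  simp only [smul_eq_mul, mul_one] at h2
  rw [h2]
  refine Finset.prod_congr rfl fun i _ => ?_
  rcases zmod_two_eq_zero_or_one (z i) with h | h
  · simp [h]; ring
  · simp [h]

end

/-! ### Projections of independent bits. -/

/-- The sums of independent bits over the fibres of a map all of whose fibres have the same size
are again independent bits. -/
lemma map_fiberSum_bitLaw {ι κ : Type*} [Fintype ι] [Fintype κ] [DecidableEq κ] (π : ι → κ) (K : ℕ)
    (hπ : ∀ T, (Finset.univ.filter fun x => π x = T).card = K) (p q : unitInterval)
    (hq : 1 - 2 * (q : ℝ) = (1 - 2 * (p : ℝ)) ^ K) :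
    (bitLaw ι p).map (fun y T => ∑ x with π x = T, y x) = bitLaw κ q := by
  classical
  have hm : Measurable (fun (y : ι → ZMod 2) (T : κ) => ∑ x with π x = T, y x) :=
    measurable_of_finite _
  have : IsProbabilityMeasure ((bitLaw ι p).map fun y T => ∑ x with π x = T, y x) :=
    Measure.isProbabilityMeasure_map hm.aemeasurable
  refine Measure.ext_of_singleton fun z => ?_
  rw [← measureReal_eq_measureReal_iff, bitLaw_real_singleton, hq,
    map_measureReal_apply hm (measurableSet_singleton z)]
  set A := (fun (y : ι → ZMod 2) (T : κ) => ∑ x with π x = T, y x) ⁻¹' {z} with hA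
  -- Fourier expansion of the point mass at z. The character indexed by S is a product of signs over
  -- the K·|S| points above S, hence has mean (1 - 2p)^(K·|S|), which is what bias q gives on S
  -- itself.
  have hind : ∀ y, A.indicator (fun _ => (1 : ℝ)) y =
      ∑ S ∈ (Finset.univ : Finset κ).powerset, ((2 : ℝ)⁻¹ ^ (Fintype.card κ) *
        (∏ T ∈ S, bitSign (z T)) * ∏ x with π x ∈ S, bitSign (y x)) := by
    intro y
    have h1 : A.indicator (fun _ => (1 : ℝ)) y =
        ∏ T, (2⁻¹ * (1 + bitSign (z T) * bitSign (∑ x with π x = T, y x))) := by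
      by_cases hy : y ∈ A
      · have hy' : (fun T : κ => ∑ x with π x = T, y x) = z := hy
        rw [Set.indicator_of_mem hy]
        refine (Finset.prod_eq_one fun T _ => ?_).symm
        rw [show ∑ x with π x = T, y x = z T from congrFun hy' T, bitSign_mul_self]; norm_num
      · rw [Set.indicator_of_notMem hy]
        have hy' : (fun T : κ => ∑ x with π x = T, y x) ≠ z := hy
        obtain ⟨T, hT⟩ := Function.ne_iff.mp hy'
        refine (Finset.prod_eq_zero (Finset.mem_univ T) ?_).symm
        rcases zmod_two_eq_zero_or_one (z T) with h | h <;>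
          rcases zmod_two_eq_zero_or_one (∑ x with π x = T, y x) with h' | h' <;>
          simp_all
    rw [h1, Finset.prod_mul_distrib, Finset.prod_const, Finset.card_univ, Finset.prod_one_add,
      Finset.mul_sum]
    refine Finset.sum_congr rfl fun S _ => ?_
    rw [mul_assoc, Finset.prod_mul_distrib]
    congr 2
    have : (Finset.univ.filter fun x => π x ∈ S) =
        S.biUnion fun T => Finset.univ.filter fun x => π x = T := by
      ext x; simp
    rw [this, Finset.prod_biUnion]
    · exact Finset.prod_congr rfl fun T _ => bitSign_sum _ _
    · intro T _ T' _ hTT'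
      refine Finset.disjoint_left.mpr fun x hx hx' => hTT' ?_
      simp only [Finset.mem_filter, Finset.mem_univ, true_and] at hx hx'
      rw [← hx, hx']
  have hcard : ∀ S : Finset κ, (Finset.univ.filter fun x => π x ∈ S).card = K * S.card := by
    intro S
    rw [Finset.card_eq_sum_card_fiberwise (f := π) (t := S) (fun x hx => by simpa using hx)]
    rw [Finset.sum_congr rfl fun T hT => ?_, Finset.sum_const, smul_eq_mul, mul_comm]
    rw [← hπ T]
    congr 1
    ext x
    simp only [Finset.mem_filter, Finset.mem_univ, true_and, and_iff_right_iff_imp]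
    rintro rfl; exact hT
  have h0 : (bitLaw ι p).real A = ∫ y, A.indicator (fun _ => (1 : ℝ)) y ∂(bitLaw ι p) := by
    rw [integral_indicator_const _ (Set.toFinite A).measurableSet]; simp
  rw [h0, integral_congr_ae (Filter.Eventually.of_forall hind),
    integral_finsetSum _ fun S _ => integrable_bitLaw p _]
  simp only [integral_const_mul, integral_bitLaw_prod_bitSign, hcard]
  simp only [div_eq_inv_mul]
  rw [Finset.prod_mul_distrib, Finset.prod_const, Finset.card_univ, Finset.prod_one_add,
    Finset.mul_sum]
  refine Finset.sum_congr rfl fun S _ => ?_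
  rw [Finset.prod_mul_distrib, Finset.prod_const, pow_mul, mul_assoc]

/-- In the variable 1 - 2p the passage to `crossover p j` is a power, so successive projections add
their levels j. -/
lemma one_sub_two_mul_crossover (p : ℝ) (j : ℕ) : 1 - 2 * crossover p j = (1 - 2 * p) ^ (2 ^ j) := by
  unfold crossover; ring

lemma crossover_crossover (p : ℝ) (i j : ℕ) : crossover (crossover p i) j = crossover p (i + j) := by
  have h := one_sub_two_mul_crossover (crossover p i) j
  have h' := one_sub_two_mul_crossover p (i + j)
  rw [one_sub_two_mul_crossover p i, ← pow_mul, ← pow_add] at h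
  linarith

lemma crossover_mem (p : unitInterval) (j : ℕ) : crossover p j ∈ unitInterval := by
  have h : |(1 - 2 * (p : ℝ)) ^ (2 ^ j)| ≤ 1 := by
    rw [abs_pow]
    refine pow_le_one₀ (abs_nonneg _) (abs_le.mpr ⟨?_, ?_⟩) <;> linarith [p.2.1, p.2.2]
  have h' := abs_le.mp h
  unfold crossover
  constructor <;> linarith [h'.1, h'.2]

/-- The crossover probability `p^(j)` as a point of the unit interval. -/
def crossoverI (p : unitInterval) (j : ℕ) : unitInterval := ⟨crossover p j, crossover_mem p j⟩

lemma crossoverI_zero (p : unitInterval) : crossoverI p 0 = p := by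
  ext; simp [crossoverI, crossover]

lemma crossoverI_crossoverI (p : unitInterval) (i j : ℕ) :
    crossoverI (crossoverI p i) j = crossoverI p (i + j) :=
  Subtype.ext (crossover_crossover p i j)

open Classical in
lemma card_coset {k m : ℕ} (B : Subspace k m) (T : Cube m ⧸ B.1) :
    (Finset.univ.filter fun x : Cube m => B.1.mkQ x = T).card = 2 ^ k := by
  obtain ⟨a, rfl⟩ := B.1.mkQ_surjective T
  have hB : Fintype.card B.1 = 2 ^ k := by
    rw [Module.card_eq_pow_finrank (K := ZMod 2), ZMod.card, B.2]
  rw [← hB, ← Finset.card_univ]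
  symm
  refine Finset.card_bij (fun b _ => a + b.1) (fun b _ => ?_) (fun b _ b' _ h => ?_) fun x hx => ?_
  · exact Finset.mem_filter.mpr ⟨Finset.mem_univ _, by simp⟩
  · exact Subtype.ext (add_left_cancel h)
  · have hx' : B.1.mkQ x = B.1.mkQ a := (Finset.mem_filter.mp hx).2
    have : x - a ∈ B.1 := by
      rwa [← Submodule.ker_mkQ B.1, LinearMap.mem_ker, map_sub, sub_eq_zero]
    exact ⟨⟨x - a, this⟩, Finset.mem_univ _, by simp⟩

lemma map_projWord_bitLaw {k m : ℕ} (B : Subspace k m) (e : CosetLabelling B) (p : unitInterval) :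
    (bitLaw (Cube m) p).map (projWord B e) = bitLaw (Cube (m - k)) (crossoverI p k) := by
  classical
  rw [← map_fiberSum_bitLaw (fun x : Cube m => e (B.1.mkQ x)) (2 ^ k) (fun T => ?_) p
    (crossoverI p k) (one_sub_two_mul_crossover p k)]
  · congr 1
    funext y z
    unfold projWord proj
    refine Finset.sum_congr (Finset.filter_congr fun x _ => ?_) fun _ _ => rfl
    rw [LinearEquiv.eq_symm_apply]
  · rw [← card_coset B (e.symm T)]
    congr 1
    refine Finset.filter_congr fun x _ => ?_
    rw [LinearEquiv.eq_symm_apply]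

lemma map_project_bitLaw {k m t M : ℕ} (path : ProjPath k m t M) (p : unitInterval) :
    (bitLaw (Cube m) p).map path.project = bitLaw (Cube M) (crossoverI p (k * t)) := by
  induction path generalizing p with
  | nil m =>
    simp only [ProjPath.project, Nat.mul_zero, crossoverI_zero]
    exact Measure.map_id
  | cons S e rest ih =>
    have h : (ProjPath.cons S e rest).project = rest.project ∘ projWord S e := rfl
    rw [h, ← Measure.map_map (measurable_of_finite _) (measurable_of_finite _),
      map_projWord_bitLaw, ih, crossoverI_crossoverI]
    congr 2
    ring

/-! ### Bounded differences for biased bits. -/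

/-- The log-likelihood ratio `ln ((1 - q) / q)`. -/
def logOdds (q : ℝ) : ℝ := Real.log ((1 - q) / q)

lemma logOdds_pos {q : ℝ} (hq0 : 0 < q) (hq : q < 1 / 2) : 0 < logOdds q :=
  Real.log_pos ((one_lt_div hq0).mpr (by linarith))

lemma exp_logOdds {q : ℝ} (hq0 : 0 < q) (hq : q < 1 / 2) : Real.exp (logOdds q) = (1 - q) / q :=
  Real.exp_log (div_pos (by linarith) hq0)

/-- The series of (e^t - 1 - t)/t² has nonnegative coefficients, so it increases for t ≥ 0;
denominators are cleared to allow t = 0. -/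
lemma exp_sub_one_sub_mul_sq_le {t L : ℝ} (ht : 0 ≤ t) (htL : t ≤ L) :
    (Real.exp t - 1 - t) * L ^ 2 ≤ t ^ 2 * (Real.exp L - 1 - L) := by
  have key : ∀ x : ℝ, HasSum (fun n : ℕ => x ^ (n + 2) / ((n + 2).factorial : ℝ))
      (Real.exp x - 1 - x) := by
    intro x
    have h := NormedSpace.expSeries_div_hasSum_exp (𝔸 := ℝ) x
    rw [← Real.exp_eq_exp_ℝ] at h
    have h2 := (hasSum_nat_add_iff' 2).mpr h
    simpa [Finset.sum_range_succ, sub_sub] using h2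
  refine hasSum_le (fun n => ?_) ((key t).mul_right (L ^ 2)) ((key L).mul_left (t ^ 2))
  rw [div_mul_eq_mul_div, mul_div_assoc']
  refine div_le_div_of_nonneg_right ?_ (by positivity)
  have : t ^ n ≤ L ^ n := pow_le_pow_left₀ ht htL n
  calc t ^ (n + 2) * L ^ 2 = t ^ n * (t ^ 2 * L ^ 2) := by ring
    _ ≤ L ^ n * (t ^ 2 * L ^ 2) := by gcongr
    _ = t ^ 2 * L ^ (n + 2) := by ring

/-- A weak form of the Kearns–Saul inequality for the moment generating function of a centred
Bernoulli variable. -/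
lemma bernoulli_mgf_le {q : ℝ} (hq0 : 0 < q) (hq : q < 1 / 2) (t : ℝ) :
    q * Real.exp (t * (1 - q)) + (1 - q) * Real.exp (-(t * q)) ≤ Real.exp (t ^ 2 / logOdds q) := by
  set L := logOdds q with hL
  have hLpos : 0 < L := logOdds_pos hq0 hq
  have hexpL : q * Real.exp L = 1 - q := by rw [exp_logOdds hq0 hq]; field_simp
  have hfac : q * Real.exp (t * (1 - q)) + (1 - q) * Real.exp (-(t * q)) ≤
      Real.exp (q * (Real.exp t - 1 - t)) := by
    have h1 : q * Real.exp (t * (1 - q)) + (1 - q) * Real.exp (-(t * q)) =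
        Real.exp (-(t * q)) * (q * (Real.exp t - 1) + 1) := by
      rw [show t * (1 - q) = -(t * q) + t by ring, Real.exp_add]; ring
    rw [h1, show q * (Real.exp t - 1 - t) = -(t * q) + q * (Real.exp t - 1) by ring, Real.exp_add]
    exact mul_le_mul_of_nonneg_left (Real.add_one_le_exp _) (Real.exp_pos _).le
  -- Up to L the Poisson-type bound `hfac` suffices: on [0, L] monotonicity reduces it to t = L,
  -- where q·e^L = 1 - q, and for t ≤ 0 it follows from e^t - 1 - t ≤ t² and qL ≤ 1. Beyond L the
  -- crude bound e^t is enough, as t ≤ t²/L.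
  rcases le_total t L with htL | htL
  · refine hfac.trans (Real.exp_le_exp.mpr ?_)
    rcases le_total 0 t with ht | ht
    · have h1 := exp_sub_one_sub_mul_sq_le ht htL
      have h2 : q * (Real.exp L - 1 - L) ≤ L := by
        have h3 : Real.exp L * (1 - L) ≤ 1 := by
          calc Real.exp L * (1 - L) ≤ Real.exp L * Real.exp (-L) := by
                gcongr; linarith [Real.add_one_le_exp (-L)]
            _ = 1 := by rw [← Real.exp_add]; simp
        nlinarith
      rw [le_div_iff₀ hLpos]
      have h3 : q * ((Real.exp t - 1 - t) * L ^ 2) ≤ t ^ 2 * L := by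
        calc q * ((Real.exp t - 1 - t) * L ^ 2) ≤ q * (t ^ 2 * (Real.exp L - 1 - L)) := by gcongr
          _ = t ^ 2 * (q * (Real.exp L - 1 - L)) := by ring
          _ ≤ t ^ 2 * L := by gcongr
      have h4 : (q * (Real.exp t - 1 - t) * L) * L ≤ t ^ 2 * L := by linarith
      exact le_of_mul_le_mul_right h4 hLpos
    · have h1 : Real.exp t - 1 - t ≤ t ^ 2 := by
        have h2 : Real.exp t * (1 - t) ≤ 1 := by
          calc Real.exp t * (1 - t) ≤ Real.exp t * Real.exp (-t) := by
                gcongr; linarith [Real.add_one_le_exp (-t)]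
            _ = 1 := by rw [← Real.exp_add]; simp
        have h3 : Real.exp t ≤ 1 / (1 - t) := by rwa [le_div_iff₀ (by linarith)]
        have h4 : 1 / (1 - t) ≤ 1 + t + t ^ 2 := by
          rw [div_le_iff₀ (by linarith)]; nlinarith [mul_nonneg (sq_nonneg t) (neg_nonneg.mpr ht)]
        linarith
      have h2 : q * L ≤ 1 := by
        nlinarith [Real.add_one_le_exp L]
      rw [le_div_iff₀ hLpos]
      calc q * (Real.exp t - 1 - t) * L = (q * L) * (Real.exp t - 1 - t) := by ring
        _ ≤ 1 * t ^ 2 := by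
          refine mul_le_mul h2 h1 ?_ zero_le_one
          linarith [Real.add_one_le_exp t]
        _ = t ^ 2 := one_mul _
  · have ht : 0 ≤ t := hLpos.le.trans htL
    have h1 : Real.exp (t * (1 - q)) ≤ Real.exp t := Real.exp_le_exp.mpr (by nlinarith)
    have h2 : Real.exp (-(t * q)) ≤ Real.exp t := Real.exp_le_exp.mpr (by nlinarith)
    calc q * Real.exp (t * (1 - q)) + (1 - q) * Real.exp (-(t * q))
        ≤ q * Real.exp t + (1 - q) * Real.exp t := by
          have : 0 ≤ 1 - q := by linarith
          gcongr
      _ = Real.exp t := by ring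
      _ ≤ Real.exp (t ^ 2 / L) := by
        refine Real.exp_le_exp.mpr ?_
        rw [le_div_iff₀ hLpos]; nlinarith

/-- Uncentred form, for a and b the values of a function at the two settings of one bit. -/
lemma two_point_exp_le {q : ℝ} (hq0 : 0 < q) (hq : q < 1 / 2) (a b : ℝ) :
    q * Real.exp a + (1 - q) * Real.exp b ≤
      Real.exp ((a - b) ^ 2 / logOdds q) * Real.exp (q * a + (1 - q) * b) := by
  have h := mul_le_mul_of_nonneg_right (bernoulli_mgf_le hq0 hq (a - b))
    (Real.exp_pos (q * a + (1 - q) * b)).le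
  refine le_trans (le_of_eq ?_) h
  rw [add_mul, mul_assoc, mul_assoc, ← Real.exp_add, ← Real.exp_add]
  ring_nf

section

variable {ι : Type*} [Fintype ι] [DecidableEq ι]

/-- The average of `F` over the coordinate `i`. -/
def average (q : ℝ) (i : ι) (F : (ι → ZMod 2) → ℝ) (y : ι → ZMod 2) : ℝ :=
  q * F (Function.update y i 1) + (1 - q) * F (Function.update y i 0)

lemma integral_average (p : unitInterval) (i : ι) (F : (ι → ZMod 2) → ℝ) :
    ∫ y, average p i F y ∂(bitLaw ι p) = ∫ y, F y ∂(bitLaw ι p) := by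
  rw [integral_fintype (integrable_bitLaw p _), integral_fintype (integrable_bitLaw p _)]
  simp only [bitLaw_real_singleton, smul_eq_mul]
  set w : ZMod 2 → ℝ := fun a => (1 + bitSign a * (1 - 2 * (p : ℝ))) / 2 with hw
  have hw0 : w 0 = 1 - p := by simp [hw]; ring
  have hw1 : w 1 = p := by simp [hw]
  have hprod : ∀ y : ι → ZMod 2, ∏ j, (1 + bitSign (y j) * (1 - 2 * (p : ℝ))) / 2 =
      w (y i) * ∏ j ∈ Finset.univ.erase i, w (y j) := fun y =>
    (Finset.mul_prod_erase Finset.univ (fun j => w (y j)) (Finset.mem_univ i)).symm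
  simp only [hprod]
  -- Flipping bit i permutes the cube; pairing each word with its flip doubles the sum and exposes
  -- both values of that bit.
  have hsplit : ∀ G : (ι → ZMod 2) → ℝ,
      2 * ∑ y, G y = ∑ y, (G (Function.update y i 0) + G (Function.update y i 1)) := by
    intro G
    let σ : (ι → ZMod 2) ≃ (ι → ZMod 2) := Equiv.addRight (Pi.single i 1)
    have h1 : ∑ y, G (σ y) = ∑ y, G y := Equiv.sum_comp σ G
    rw [two_mul]
    nth_rewrite 2 [← h1]
    rw [← Finset.sum_add_distrib]
    refine Finset.sum_congr rfl fun y _ => ?_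
    have hσ : σ y = Function.update y i (y i + 1) := by
      funext j
      by_cases hj : j = i
      · subst hj; simp [σ]
      · simp [σ, hj]
    rw [hσ]
    rcases zmod_two_eq_zero_or_one (y i) with h | h
    · have : Function.update y i 0 = y := by rw [← h, Function.update_eq_self]
      rw [h, zero_add, this]
    · have : Function.update y i 1 = y := by rw [← h, Function.update_eq_self]
      rw [h, show (1 : ZMod 2) + 1 = 0 by decide, this, add_comm]
  have herase : ∀ (y : ι → ZMod 2) (a : ZMod 2),
      ∏ j ∈ Finset.univ.erase i, w (Function.update y i a j) =
        ∏ j ∈ Finset.univ.erase i, w (y j) := fun y a =>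
    Finset.prod_congr rfl fun j hj => by rw [Function.update_of_ne (Finset.ne_of_mem_erase hj)]
  refine mul_left_cancel₀ (two_ne_zero' ℝ) ?_
  rw [hsplit, hsplit]
  refine Finset.sum_congr rfl fun y _ => ?_
  simp only [herase, Function.update_self, hw0, hw1, average, Function.update_idem]
  ring

/-- Bits are averaged out one at a time. Averaging over bit i costs a factor exp(c i² / L), keeps
the mean and the difference bounds, and removes the dependence on i. -/
lemma integral_exp_le_of_dependsOn (p : unitInterval) (hp0 : 0 < (p : ℝ)) (hp : (p : ℝ) < 1 / 2)
    (c : ι → ℝ) (s : Finset ι) (F : (ι → ZMod 2) → ℝ)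
    (hdep : ∀ y y' : ι → ZMod 2, (∀ i ∈ s, y i = y' i) → F y = F y')
    (hF : ∀ i y, |F (Function.update y i 1) - F (Function.update y i 0)| ≤ c i) :
    ∫ y, Real.exp (F y) ∂(bitLaw ι p) ≤
      Real.exp (∫ y, F y ∂(bitLaw ι p) + (∑ i ∈ s, c i ^ 2) / logOdds p) := by
  induction s using Finset.induction_on generalizing F with
  | empty =>
    have h : F = fun _ => F 0 := funext fun y => hdep y 0 (by simp)
    rw [h]; simp
  | insert i s hi ih =>
    have hL := logOdds_pos hp0 hp
    have hdep' : ∀ y y' : ι → ZMod 2, (∀ j ∈ s, y j = y' j) →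
        average p i F y = average p i F y' := by
      intro y y' hyy'
      have (a : ZMod 2) : F (Function.update y i a) = F (Function.update y' i a) := by
        refine hdep _ _ fun j hj => ?_
        by_cases hji : j = i
        · subst hji; simp
        · rw [Function.update_of_ne hji, Function.update_of_ne hji]
          exact hyy' j (Finset.mem_of_mem_insert_of_ne hj hji)
      simp only [average, this]
    have hF' : ∀ j y, |average p i F (Function.update y j 1) -
        average p i F (Function.update y j 0)| ≤ c j := by
      intro j y
      by_cases hji : j = i
      · subst hji
        have := (abs_nonneg _).trans (hF j y)
        simpa [average] using this
      · have h1 := hF j (Function.update y i 1)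
        have h0 := hF j (Function.update y i 0)
        simp only [average]
        simp only [Function.update_comm (Ne.symm hji)] at h1 h0 ⊢
        rw [abs_le] at h1 h0 ⊢
        have hp1 : 0 ≤ 1 - (p : ℝ) := by linarith
        constructor <;> nlinarith [h1.1, h1.2, h0.1, h0.2]
    have hstep : ∀ y, average p i (fun y => Real.exp (F y)) y ≤
        Real.exp (c i ^ 2 / logOdds p) * Real.exp (average p i F y) := by
      intro y
      refine (two_point_exp_le hp0 hp _ _).trans ?_
      refine mul_le_mul_of_nonneg_right (Real.exp_le_exp.mpr ?_) (Real.exp_pos _).le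
      exact div_le_div_of_nonneg_right (sq_le_sq.mpr ((hF i y).trans (le_abs_self _))) hL.le
    rw [← integral_average p i (fun y => Real.exp (F y))]
    refine (integral_mono (integrable_bitLaw p _) (integrable_bitLaw p _) hstep).trans ?_
    rw [integral_const_mul]
    refine (mul_le_mul_of_nonneg_left (ih (average p i F) hdep' hF') (Real.exp_pos _).le).trans ?_
    rw [← Real.exp_add, integral_average, Finset.sum_insert hi]
    refine Real.exp_le_exp.mpr (le_of_eq ?_)
    ring

/-- A bounded differences inequality for independent bits. -/
lemma integral_exp_le (p : unitInterval) (hp0 : 0 < (p : ℝ)) (hp : (p : ℝ) < 1 / 2)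
    (c : ι → ℝ) (F : (ι → ZMod 2) → ℝ)
    (hF : ∀ i y, |F (Function.update y i 1) - F (Function.update y i 0)| ≤ c i) :
    ∫ y, Real.exp (F y) ∂(bitLaw ι p) ≤
      Real.exp (∫ y, F y ∂(bitLaw ι p) + (∑ i, c i ^ 2) / logOdds p) :=
  integral_exp_le_of_dependsOn p hp0 hp c Finset.univ F
    (fun _ _ h => congrArg F (funext fun i => h i (Finset.mem_univ i))) hF

end

lemma bitLaw_real_le_integral {ι : Type*} [Fintype ι] (p : unitInterval)
    (A : Set (ι → ZMod 2)) (F : (ι → ZMod 2) → ℝ) (hF0 : ∀ y, 0 ≤ F y) (hF1 : ∀ y ∈ A, 1 ≤ F y) :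
    (bitLaw ι p).real A ≤ ∫ y, F y ∂(bitLaw ι p) := by
  have h0 : (bitLaw ι p).real A = ∫ y, A.indicator (fun _ => (1 : ℝ)) y ∂(bitLaw ι p) := by
    rw [integral_indicator_const _ (Set.toFinite A).measurableSet]; simp
  rw [h0]
  refine integral_mono (integrable_bitLaw p _) (integrable_bitLaw p _) fun y => ?_
  by_cases hy : y ∈ A
  · simpa [hy] using hF1 y hy
  · simpa [hy] using hF0 y

/-! ### Maximum likelihood decoding of first-order Reed-Muller codes. -/

/-- The evaluation vector of the affine function `z ↦ a + ∑ i, b i * z i`. -/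
def affineWord (n : ℕ) : (ZMod 2 × Cube n) →ₗ[ZMod 2] Word n where
  toFun ab := fun z => ab.1 + ∑ i, ab.2 i * z i
  map_add' x y := by
    funext z
    simp only [Prod.fst_add, Prod.snd_add, Pi.add_apply, add_mul, Finset.sum_add_distrib]
    ring
  map_smul' c x := by
    funext z
    simp only [Prod.smul_fst, Prod.smul_snd, Pi.smul_apply, smul_eq_mul, mul_add, Finset.mul_sum,
      RingHom.id_apply, mul_assoc]

lemma affineWord_apply {n : ℕ} (ab : ZMod 2 × Cube n) (z : Cube n) :
    affineWord n ab z = ab.1 + ∑ i, ab.2 i * z i := rfl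

lemma prod_pow_mem_range_affineWord {n : ℕ} (d : Fin n →₀ ℕ) (hd : (d.sum fun _ e => e) ≤ 1) :
    (fun z : Cube n => ∏ i ∈ d.support, z i ^ d i) ∈ LinearMap.range (affineWord n) := by
  classical
  rcases d.support.eq_empty_or_nonempty with h | ⟨i, hi⟩
  · refine ⟨(1, 0), ?_⟩
    funext z
    simp [affineWord_apply, h]
  · have hone : ∀ j ∈ d.support, 1 ≤ d j := fun j hj =>
      Nat.one_le_iff_ne_zero.mpr (Finsupp.mem_support_iff.mp hj)
    have hsum : d i + ∑ j ∈ d.support.erase i, d j ≤ 1 := by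
      rw [Finset.add_sum_erase _ _ hi]; exact hd
    have hi1 := hone i hi
    have herase : d.support.erase i = ∅ := by
      refine Finset.eq_empty_of_forall_notMem fun j hj => ?_
      have h1 := Finset.single_le_sum (f := fun j => d j) (fun _ _ => Nat.zero_le _) hj
      have h2 := hone j (Finset.mem_of_mem_erase hj)
      omega
    refine ⟨(0, Pi.single i 1), ?_⟩
    funext z
    rw [← Finset.mul_prod_erase _ _ hi, herase, show d i = 1 by omega]
    simp [affineWord_apply, Pi.single_apply]

lemma mem_reedMuller_one {n : ℕ} {c : Word n} (hc : c ∈ reedMuller n 1) :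
    c ∈ LinearMap.range (affineWord n) := by
  obtain ⟨f, hf, hcf⟩ := hc
  have h : c = ∑ d ∈ f.support, f.coeff d • fun z : Cube n => ∏ i ∈ d.support, z i ^ d i := by
    funext z
    rw [hcf, MvPolynomial.eval_eq, Finset.sum_apply]
    rfl
  rw [h]
  exact Submodule.sum_mem _ fun d hd => Submodule.smul_mem _ _
    (prod_pow_mem_range_affineWord d ((MvPolynomial.le_totalDegree hd).trans hf))

lemma zero_mem_reedMuller (n r : ℕ) : (0 : Word n) ∈ reedMuller n r :=
  ⟨0, by simp, fun z => by simp⟩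

/-- If the linear part involves the variable i, translation by the i-th unit vector flips the value
and so injects zeros into nonzeros; otherwise the word is the constant 1. -/
lemma two_pow_le_two_mul_card_support {n : ℕ} (ab : ZMod 2 × Cube n) (h : affineWord n ab ≠ 0) :
    2 ^ n ≤ 2 * (Finset.univ.filter fun z => affineWord n ab z ≠ 0).card := by
  classical
  have hcard : Fintype.card (Cube n) = 2 ^ n := by simp
  have hpart := Finset.card_filter_add_card_filter_not (s := (Finset.univ : Finset (Cube n)))
    (fun z => affineWord n ab z ≠ 0)
  rw [Finset.card_univ, hcard] at hpart
  suffices hle : (Finset.univ.filter fun z => ¬ affineWord n ab z ≠ 0).card ≤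
      (Finset.univ.filter fun z => affineWord n ab z ≠ 0).card by omega
  by_cases hb : ab.2 = 0
  · have ha : ab.1 ≠ 0 := by
      intro ha; exact h (by rw [show ab = 0 from Prod.ext ha hb, map_zero])
    have hempty : (Finset.univ.filter fun z => ¬ affineWord n ab z ≠ 0) = ∅ :=
      Finset.filter_eq_empty_iff.mpr fun z _ => by simp [affineWord_apply, hb, ha]
    rw [hempty, Finset.card_empty]
    exact Nat.zero_le _
  · obtain ⟨i, hi⟩ := Function.ne_iff.mp hb
    have hi1 : ab.2 i = 1 := (zmod_two_eq_zero_or_one _).resolve_left hi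
    refine Finset.card_le_card_of_injOn (fun z => z + Pi.single i 1) (fun z hz => ?_)
      (fun z _ z' _ hzz' => add_right_cancel hzz')
    have hz' : affineWord n ab z = 0 := by
      simpa using (Finset.mem_filter.mp hz).2
    refine Finset.mem_coe.mpr (Finset.mem_filter.mpr ⟨Finset.mem_univ _, ?_⟩)
    have : affineWord n ab (z + Pi.single i 1) = affineWord n ab z + ab.2 i := by
      simp [affineWord_apply, mul_add, Finset.sum_add_distrib, Pi.single_apply, add_assoc]
    rw [this, hz', hi1]
    simp

/-- Consequently c is at least as close to y as 0 exactly when the signs of y over the support of c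
have sum at most 0. -/
lemma hammingDist_eq_sum_bitSign {n : ℕ} (y c : Word n) :
    (hammingDist y c : ℝ) = hammingDist y 0 + ∑ z with c z ≠ 0, bitSign (y z) := by
  classical
  simp only [hammingDist, Finset.card_filter, Finset.sum_filter, Nat.cast_sum]
  rw [← Finset.sum_add_distrib]
  refine Finset.sum_congr rfl fun z _ => ?_
  rcases zmod_two_eq_zero_or_one (y z) with h | h <;>
    rcases zmod_two_eq_zero_or_one (c z) with h' | h' <;> simp [h, h']

/-- The Chernoff bound, at threshold one half, for the event that at least half of the bits in `s`
equal one. -/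
lemma bitLaw_real_sum_bitSign_nonpos_le {ι : Type*} [Fintype ι] (q : unitInterval)
    (hq0 : 0 < (q : ℝ)) (hq : (q : ℝ) < 1 / 2) (s : Finset ι) :
    (bitLaw ι q).real {y | ∑ z ∈ s, bitSign (y z) ≤ 0} ≤
      Real.exp (s.card / 2 * Real.log (1 - (1 - 2 * (q : ℝ)) ^ 2)) := by
  set l := logOdds q with hl
  have hlpos : 0 < l := logOdds_pos hq0 hq
  -- The tilt l/2 is the Chernoff optimum: each factor then has mean 2·√(q(1-q)), the square root of
  -- 1 - (1-2q)².
  set f : ZMod 2 → ℝ := fun a => Real.exp (-(bitSign a * (l / 2))) with hf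
  have h1 := bitLaw_real_le_integral q {y : ι → ZMod 2 | ∑ z ∈ s, bitSign (y z) ≤ 0}
    (fun y => ∏ z ∈ s, f (y z)) (fun y => Finset.prod_nonneg fun z _ => (Real.exp_pos _).le)
    (fun y hy => by
      have hy' : ∑ z ∈ s, bitSign (y z) ≤ 0 := hy
      simp only [hf]
      rw [← Real.exp_sum, Finset.sum_neg_distrib, ← Finset.sum_mul]
      exact Real.one_le_exp (by nlinarith))
  refine h1.trans (le_of_eq ?_)
  rw [integral_bitLaw_prod_finset]
  set x : ℝ := (q : ℝ) * f 1 + (1 - q) * f 0 with hx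
  have hx0 : 0 < x := by
    have : 0 < 1 - (q : ℝ) := by linarith
    positivity
  have hx2 : x ^ 2 = 1 - (1 - 2 * (q : ℝ)) ^ 2 := by
    have e1 : f 1 ^ 2 = (1 - q) / q := by
      simp only [hf, bitSign_one]
      rw [← Real.exp_nat_mul, ← exp_logOdds hq0 hq]; congr 1; push_cast; ring
    have e10 : f 1 * f 0 = 1 := by
      simp only [hf, bitSign_one, bitSign_zero]
      rw [← Real.exp_add]; simp
    have e0 : f 0 ^ 2 = q / (1 - q) := by
      have : f 1 ^ 2 * f 0 ^ 2 = 1 := by rw [← mul_pow, e10, one_pow]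
      rw [e1] at this
      have hq1 : 1 - (q : ℝ) ≠ 0 := by linarith
      field_simp at this ⊢
      linarith
    have : x ^ 2 = q ^ 2 * f 1 ^ 2 + 2 * q * (1 - q) * (f 1 * f 0) + (1 - q) ^ 2 * f 0 ^ 2 := by
      rw [hx]; ring
    rw [this, e1, e10, e0]
    have hq1 : 1 - (q : ℝ) ≠ 0 := by linarith
    field_simp
    ring
  rw [← hx2, Real.log_pow]
  rw [show (s.card : ℝ) / 2 * ((2 : ℕ) * Real.log x) = s.card * Real.log x by push_cast; ring,
    Real.exp_nat_mul, Real.exp_log hx0]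

lemma log_one_sub_sq_nonpos {q : ℝ} (hq0 : 0 < q) (hq : q < 1 / 2) :
    Real.log (1 - (1 - 2 * q) ^ 2) ≤ 0 :=
  Real.log_nonpos (by nlinarith) (by nlinarith)

/-- The error probability of maximum likelihood decoding of the all-zeros codeword of `RM(n, 1)`. -/
lemma bitLaw_real_decoder_ne_zero_le {n : ℕ} (D : Word n → Word n)
    (hD : IsMLDecoder (reedMuller n 1) D) (q : unitInterval)
    (hq0 : 0 < (q : ℝ)) (hq : (q : ℝ) < 1 / 2) :
    (bitLaw (Cube n) q).real {y | D y ≠ 0} ≤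
      2 * 2 ^ n * Real.exp (2 ^ n / 4 * Real.log (1 - (1 - 2 * (q : ℝ)) ^ 2)) := by
  classical
  set S : Finset (ZMod 2 × Cube n) := Finset.univ.filter fun ab => affineWord n ab ≠ 0 with hS
  have hsub : {y | D y ≠ 0} ⊆ ⋃ ab ∈ S,
      {y : Word n | ∑ z ∈ Finset.univ.filter (fun z => affineWord n ab z ≠ 0),
        bitSign (y z) ≤ 0} := by
    intro y hy
    obtain ⟨ab, hab⟩ := mem_reedMuller_one (hD y).1
    refine Set.mem_iUnion₂.mpr ⟨ab, Finset.mem_filter.mpr ⟨Finset.mem_univ _, ?_⟩, ?_⟩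
    · rw [hab]; exact hy
    · have h1 := (hD y).2 0 (zero_mem_reedMuller n 1)
      have h2 := hammingDist_eq_sum_bitSign y (D y)
      have h3 : (hammingDist y (D y) : ℝ) ≤ hammingDist y 0 := by exact_mod_cast h1
      rw [Set.mem_ofPred_eq, hab]
      linarith
  refine (measureReal_mono hsub (measure_ne_top _ _)).trans ((measureReal_biUnion_finset_le _ _).trans ?_)
  have hcard : (S.card : ℝ) ≤ 2 * 2 ^ n := by
    have : S.card ≤ 2 * 2 ^ n := by
      refine (Finset.card_le_univ S).trans (le_of_eq ?_)
      simp
    exact_mod_cast this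
  refine (Finset.sum_le_card_nsmul _ _
    (Real.exp (2 ^ n / 4 * Real.log (1 - (1 - 2 * (q : ℝ)) ^ 2))) fun ab hab => ?_).trans ?_
  · refine (bitLaw_real_sum_bitSign_nonpos_le q hq0 hq _).trans (Real.exp_le_exp.mpr ?_)
    have hw : ((2 : ℝ) ^ n) ≤
        2 * (Finset.univ.filter fun z => affineWord n ab z ≠ 0).card := by
      exact_mod_cast two_pow_le_two_mul_card_support ab (Finset.mem_filter.mp hab).2
    -- The logarithm is nonpositive, so the lower bound on the weight gives an upper bound on the
    -- exponent.
    refine mul_le_mul_of_nonpos_right ?_ (log_one_sub_sq_nonpos hq0 hq)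
    linarith
  · rw [nsmul_eq_mul]
    gcongr

/-- Compares the two exponents, with K = 2^k and v = u^K. Bernoulli's inequality 1 - v ≤ K(1 - u)
bounds the odds by 4K/(1 - v²), so their logarithm is at most 4K - 1 + X with X = -log(1 - v²); then
v² ≤ X and v² ≤ 1 finish. -/
lemma log_odds_mul_le {u : ℝ} (hu0 : 0 < u) (hu1 : u < 1) {K : ℕ} (hK : 1 ≤ K) :
    (u ^ K) ^ 2 / 4 * Real.log ((1 + u) / (1 - u)) ≤ K * -Real.log (1 - (u ^ K) ^ 2) := by
  set v := u ^ K with hv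
  have hv0 : 0 < v := by positivity
  have hv1 : v < 1 := pow_lt_one₀ hu0.le hu1 (by omega)
  have hv2 : v ^ 2 < 1 := by nlinarith
  have hK1 : (1 : ℝ) ≤ K := by exact_mod_cast hK
  set X := -Real.log (1 - v ^ 2) with hX
  have hXv : v ^ 2 ≤ X := by
    have := Real.log_le_sub_one_of_pos (show 0 < 1 - v ^ 2 by linarith)
    linarith
  have hbern : 1 - v ≤ K * (1 - u) := by
    have := one_add_mul_le_pow (a := u - 1) (by linarith) K
    rw [add_sub_cancel] at this
    linarith
  have hle : (1 + u) / (1 - u) ≤ 4 * K / (1 - v ^ 2) := by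
    rw [div_le_div_iff₀ (by linarith) (by linarith)]
    have h1 : 1 - v ^ 2 ≤ 2 * (K * (1 - u)) := by nlinarith
    nlinarith [mul_nonneg (by linarith : (0:ℝ) ≤ K) (by linarith : 0 ≤ 1 - u)]
  have hlog : Real.log ((1 + u) / (1 - u)) ≤ Real.log (4 * K) + X := by
    refine (Real.log_le_log (div_pos (by linarith) (by linarith)) hle).trans (le_of_eq ?_)
    rw [Real.log_div (by positivity) (by linarith)]
    ring
  have hlogK : Real.log (4 * K) ≤ 4 * K - 1 := Real.log_le_sub_one_of_pos (by positivity)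
  calc v ^ 2 / 4 * Real.log ((1 + u) / (1 - u)) ≤ v ^ 2 / 4 * (4 * K - 1 + X) := by
        gcongr; linarith
    _ = v ^ 2 * (4 * K - 1) / 4 + v ^ 2 * X / 4 := by ring
    _ ≤ X * (4 * K - 1) / 4 + 1 * X / 4 := by
        have : 0 ≤ X := (sq_nonneg v).trans hXv
        have h4 : (0 : ℝ) ≤ 4 * K - 1 := by linarith
        gcongr
    _ = K * X := by ring

/-! ### Counting subspaces. -/

lemma exists_linearEquiv_apply_eq {V : Type*} [AddCommGroup V] [Module (ZMod 2) V] {v w : V}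
    (hv : v ≠ 0) (hw : w ≠ 0) : ∃ g : V ≃ₗ[ZMod 2] V, g v = w := by
  let f := (LinearEquiv.toSpanNonzeroSingleton (ZMod 2) V v hv).symm ≪≫ₗ
    LinearEquiv.toSpanNonzeroSingleton (ZMod 2) V w hw
  obtain ⟨g, hg⟩ := Submodule.exists_linearEquiv_restrict_eq f
  refine ⟨g, ?_⟩
  have h1 : LinearEquiv.toSpanNonzeroSingleton (ZMod 2) V v hv 1 =
      ⟨v, Submodule.mem_span_singleton_self v⟩ := LinearEquiv.toSpanNonzeroSingleton_one _ _ _ _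
  have h2 := hg ⟨v, Submodule.mem_span_singleton_self v⟩
  have h3 : f ⟨v, Submodule.mem_span_singleton_self v⟩ =
      LinearEquiv.toSpanNonzeroSingleton (ZMod 2) V w hw 1 := by
    rw [← h1]
    simp only [f, LinearEquiv.trans_apply, LinearEquiv.symm_apply_apply]
  exact h2.symm.trans (by rw [h3, LinearEquiv.toSpanNonzeroSingleton_one])

open Classical in
lemma card_subspaces_mem_le {k m : ℕ} {v w : Cube m} (hv : v ≠ 0) (hw : w ≠ 0) :
    (Finset.univ.filter fun B : Subspace k m => v ∈ B.1).card ≤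
      (Finset.univ.filter fun B : Subspace k m => w ∈ B.1).card := by
  obtain ⟨g, hg⟩ := exists_linearEquiv_apply_eq hv hw
  refine Finset.card_le_card_of_injOn
    (fun B => ⟨B.1.map (g : Cube m →ₗ[ZMod 2] Cube m), 
      (LinearEquiv.finrank_map_eq g B.1).trans B.2⟩) (fun B hB => ?_) fun B _ B' _ h => ?_
  · have hB' : v ∈ B.1 := (Finset.mem_filter.mp hB).2
    exact Finset.mem_coe.mpr (Finset.mem_filter.mpr
      ⟨Finset.mem_univ _, Submodule.mem_map.mpr ⟨v, hB', hg⟩⟩)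
  · exact Subtype.ext (Submodule.map_injective_of_injective g.injective (Subtype.mk.inj h))

lemma card_subspace {k m : ℕ} (B : Subspace k m) [Fintype B.1] : Fintype.card B.1 = 2 ^ k := by
  rw [Module.card_eq_pow_finrank (K := ZMod 2), ZMod.card, B.2]

open Classical in
-- Double counting of pairs (w, B) with w a nonzero vector of B. Linear automorphisms act
-- transitively on nonzero vectors, so all w contribute equally.
lemma card_subspaces_mem_mul {k m : ℕ} {v : Cube m} (hv : v ≠ 0) :
    (2 ^ m - 1) * (Finset.univ.filter fun B : Subspace k m => v ∈ B.1).card =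
      Fintype.card (Subspace k m) * (2 ^ k - 1) := by
  have h := Finset.sum_card_bipartiteAbove_eq_sum_card_bipartiteBelow
    (s := (Finset.univ : Finset (Cube m)).erase 0) (t := (Finset.univ : Finset (Subspace k m)))
    (fun w B => w ∈ B.1)
  have h1 : ∀ w ∈ (Finset.univ : Finset (Cube m)).erase 0,
      (Finset.bipartiteAbove (fun w (B : Subspace k m) => w ∈ B.1) Finset.univ w).card =
        (Finset.univ.filter fun B : Subspace k m => v ∈ B.1).card := fun w hw =>
    le_antisymm (card_subspaces_mem_le (Finset.ne_of_mem_erase hw) hv)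
      (card_subspaces_mem_le hv (Finset.ne_of_mem_erase hw))
  have h2 : ∀ B ∈ (Finset.univ : Finset (Subspace k m)),
      (Finset.bipartiteBelow (fun w (B : Subspace k m) => w ∈ B.1)
        ((Finset.univ : Finset (Cube m)).erase 0) B).card = 2 ^ k - 1 := by
    intro B _
    have : Finset.bipartiteBelow (fun w (B : Subspace k m) => w ∈ B.1)
        ((Finset.univ : Finset (Cube m)).erase 0) B =
          (Finset.univ.filter fun w => w ∈ B.1).erase 0 := by
      ext w; simp [Finset.bipartiteBelow]
    rw [this, Finset.card_erase_of_mem (by simp), ← card_subspace B, Fintype.card_subtype (fun w => w ∈ B.1)]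
  rw [Finset.sum_congr rfl h1, Finset.sum_congr rfl h2, Finset.sum_const, Finset.sum_const,
    Finset.card_erase_of_mem (Finset.mem_univ _), Finset.card_univ, Finset.card_univ] at h
  simpa using h

lemma card_linearIndependent_span_eq {k m : ℕ} (B : Subspace k m) :
    Nat.card {s : {s : Fin k → Cube m // LinearIndependent (ZMod 2) s} //
      Submodule.span (ZMod 2) (Set.range s.1) = B.1} =
      Nat.card {s : Fin k → B.1 // LinearIndependent (ZMod 2) s} := by
  have hmem (s : {s : {s : Fin k → Cube m // LinearIndependent (ZMod 2) s} //
      Submodule.span (ZMod 2) (Set.range s.1) = B.1}) (i : Fin k) : s.1.1 i ∈ B.1 := by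
    exact s.2.le (Submodule.subset_span ⟨i, rfl⟩)
  refine Nat.card_congr
    { toFun := fun s => ⟨fun i => ⟨s.1.1 i, hmem s i⟩, LinearIndependent.of_comp B.1.subtype s.1.2⟩
      invFun := fun s => ⟨⟨fun i => (s.1 i : Cube m),
        s.2.map' B.1.subtype (Submodule.ker_subtype _)⟩, ?_⟩
      left_inv := fun s => rfl
      right_inv := fun s => rfl }
  have hli : LinearIndependent (ZMod 2) fun i => (s.1 i : Cube m) :=
    s.2.map' B.1.subtype (Submodule.ker_subtype _)
  refine Submodule.eq_of_le_of_finrank_eq (Submodule.span_le.mpr ?_) ?_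
  · rintro _ ⟨i, rfl⟩; exact (s.1 i).2
  · rw [finrank_span_eq_card hli, B.2, Fintype.card_fin]

/-- Independent k-tuples are counted according to their span; each fibre is the set of ordered bases
of one subspace. -/
lemma card_subspaces_mul {k m : ℕ} (hkm : k ≤ m) :
    ∏ i : Fin k, (2 ^ m - 2 ^ i.val) =
      Fintype.card (Subspace k m) * ∏ i : Fin k, (2 ^ k - 2 ^ i.val) := by
  classical
  have h1 := card_linearIndependent (K := ZMod 2) (V := Cube m) (k := k) (by simpa using hkm)
  simp only [ZMod.card, Module.finrank_fintype_fun_eq_card, Fintype.card_fin] at h1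
  rw [← h1]
  let φ : {s : Fin k → Cube m // LinearIndependent (ZMod 2) s} → Subspace k m := fun s =>
    ⟨Submodule.span (ZMod 2) (Set.range s.1), by
      rw [finrank_span_eq_card s.2, Fintype.card_fin]⟩
  rw [← Nat.card_congr (Equiv.sigmaFiberEquiv φ), Nat.card_sigma,
    Finset.sum_congr rfl fun B _ => ?_, Finset.sum_const, Finset.card_univ, smul_eq_mul]
  have h2 := card_linearIndependent (K := ZMod 2) (V := B.1) (k := k) (by rw [B.2])
  simp only [ZMod.card, B.2] at h2
  rw [← h2, ← card_linearIndependent_span_eq B]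
  exact Nat.card_congr (Equiv.subtypeEquivRight fun s => Subtype.ext_iff)

lemma gaussBinom_eq_card {k m : ℕ} (hkm : k ≤ m) :
    gaussBinom k m = Fintype.card (Subspace k m) := by
  have h := congrArg (Nat.cast (R := ℝ)) (card_subspaces_mul hkm)
  have hcast (n : ℕ) (hn : k ≤ n) : ((∏ i : Fin k, (2 ^ n - 2 ^ i.val) : ℕ) : ℝ) =
      ∏ i ∈ Finset.range k, ((2 : ℝ) ^ n - 2 ^ i) := by
    rw [Finset.prod_range, Nat.cast_prod]
    refine Finset.prod_congr rfl fun i _ => ?_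
    rw [Nat.cast_sub (Nat.pow_le_pow_right (by norm_num) (by omega))]
    push_cast; rfl
  rw [Nat.cast_mul, hcast m hkm, hcast k le_rfl] at h
  rw [gaussBinom, Finset.prod_div_distrib, h]
  refine mul_div_cancel_right₀ _ (Finset.prod_ne_zero_iff.mpr fun i hi => ?_)
  have : (2 : ℝ) ^ i < 2 ^ k := pow_lt_pow_right₀ (by norm_num) (Finset.mem_range.mp hi)
  linarith

lemma gaussBinom_pos {k m : ℕ} (hkm : k ≤ m) : 0 < gaussBinom k m := by
  refine Finset.prod_pos fun i hi => div_pos ?_ ?_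
  · have : (2 : ℝ) ^ i < 2 ^ m :=
      pow_lt_pow_right₀ (by norm_num) ((Finset.mem_range.mp hi).trans_le hkm)
    linarith
  · have : (2 : ℝ) ^ i < 2 ^ k := pow_lt_pow_right₀ (by norm_num) (Finset.mem_range.mp hi)
    linarith

lemma gaussBinom_mono {k M m : ℕ} (hkM : k ≤ M) (hMm : M ≤ m) :
    gaussBinom k M ≤ gaussBinom k m := by
  have hlt {n i : ℕ} (hn : k ≤ n) (hi : i ∈ Finset.range k) : (0 : ℝ) < 2 ^ n - 2 ^ i := by
    have : (2 : ℝ) ^ i < 2 ^ n :=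
      pow_lt_pow_right₀ (by norm_num) ((Finset.mem_range.mp hi).trans_le hn)
    linarith
  refine Finset.prod_le_prod (fun i hi => (div_pos (hlt hkM hi) (hlt le_rfl hi)).le) fun i hi => ?_
  refine div_le_div_of_nonneg_right ?_ (hlt le_rfl hi).le
  have : (2 : ℝ) ^ M ≤ 2 ^ m := pow_le_pow_right₀ (by norm_num) hMm
  linarith

/-! ### The majority vote and one decoder iteration. -/

open Classical in
/-- The points other than `x` of the coset `x + B`. -/
def puncturedCoset {k m : ℕ} (B : Subspace k m) (x : Cube m) : Finset (Cube m) :=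
  (Finset.univ.filter fun z => B.1.mkQ z = B.1.mkQ x).erase x

lemma mem_puncturedCoset {k m : ℕ} {B : Subspace k m} {x z : Cube m} :
    z ∈ puncturedCoset B x ↔ z ≠ x ∧ z - x ∈ B.1 := by
  classical
  unfold puncturedCoset
  rw [Finset.mem_erase, Finset.mem_filter, ← Submodule.ker_mkQ B.1, LinearMap.mem_ker, map_sub,
    sub_eq_zero, Submodule.ker_mkQ]
  simp only [Finset.mem_univ, true_and]

lemma card_puncturedCoset {k m : ℕ} (B : Subspace k m) (x : Cube m) :
    (puncturedCoset B x).card = 2 ^ k - 1 := by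
  classical
  unfold puncturedCoset
  rw [Finset.card_erase_of_mem, card_coset]
  exact Finset.mem_filter.mpr ⟨Finset.mem_univ _, rfl⟩

lemma proj_mkQ {k m : ℕ} (B : Subspace k m) (y : Word m) (x : Cube m) :
    proj B y (B.1.mkQ x) = y x + ∑ z ∈ puncturedCoset B x, y z := by
  classical
  unfold proj puncturedCoset
  rw [Finset.add_sum_erase]
  exact Finset.mem_filter.mpr ⟨Finset.mem_univ _, rfl⟩

/-- The sum over all subspaces `B` of the sign of the parity of `y` on the coset `x + B` without
its point `x`. -/
def signSum {m : ℕ} (k : ℕ) (x : Cube m) (y : Word m) : ℝ :=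
  ∑ B : Subspace k m, ∏ z ∈ puncturedCoset B x, bitSign (y z)

/-- The sign of y x times that of the rest of the coset is the sign of the projection, which is -1
exactly at a disagreement. Hence positivity of `signSum` means that x is flipped if and only if y x
= 1. -/
lemma bitSign_mul_signSum {k m : ℕ} (x : Cube m) (y : Word m) :
    bitSign (y x) * signSum k x y =
      Nat.card (Subspace k m) - 2 * disagreements y (fun _ : Subspace k m => 0) x := by
  classical
  have hd : disagreements y (fun _ : Subspace k m => 0) x =
      (Finset.univ.filter fun B : Subspace k m => proj B y (B.1.mkQ x) ≠ 0).card := by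
    unfold disagreements
    rw [Nat.card_eq_fintype_card, Fintype.card_subtype]
    rfl
  rw [hd, Nat.card_eq_fintype_card, signSum, Finset.mul_sum, Finset.card_filter,
    ← Finset.card_univ, Finset.card_eq_sum_ones]
  push_cast
  rw [Finset.mul_sum, ← Finset.sum_sub_distrib]
  refine Finset.sum_congr rfl fun B _ => ?_
  rw [← bitSign_sum, ← bitSign_add, ← proj_mkQ]
  rcases zmod_two_eq_zero_or_one (proj B y (B.1.mkQ x)) with h | h
  · rw [h]; simp
  · rw [h]; norm_num

lemma aggregate_zero_eq_zero {k m : ℕ} (y : Word m) (h : ∀ x, 0 < signSum k x y) :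
    aggregate y (fun _ : Subspace k m => 0) = 0 := by
  classical
  funext x
  have hx := h x
  have hs := bitSign_mul_signSum (k := k) x y
  unfold aggregate
  simp only [Pi.zero_apply]
  rcases zmod_two_eq_zero_or_one (y x) with h0 | h1
  · rw [h0, bitSign_zero] at hs
    rw [if_neg (by linarith), h0, add_zero]
  · rw [h1, bitSign_one] at hs
    rw [if_pos (by linarith), h1]
    decide

lemma rpaIteration_eq_zero {k m : ℕ} (e : ∀ B : Subspace k m, CosetLabelling B)
    (D : Word (m - k) → Word (m - k)) (y : Word m) (hD : ∀ B, D (projWord B (e B) y) = 0)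
    (h : ∀ x, 0 < signSum k x y) : rpaIteration e D y = 0 := by
  have : (fun (B : Subspace k m) (T : Cube m ⧸ B.1) => D (projWord B (e B) y) (e B T)) =
      fun _ => 0 := by
    funext B T; rw [hD]; rfl
  unfold rpaIteration
  rw [this, aggregate_zero_eq_zero y h]

lemma abs_prod_bitSign_update_le {m : ℕ} (s : Finset (Cube m)) (y : Word m) (z : Cube m) :
    |∏ x ∈ s, bitSign (Function.update y z 1 x) - ∏ x ∈ s, bitSign (Function.update y z 0 x)| ≤
      if z ∈ s then 2 else 0 := by
  classical
  have habs : ∀ y : Word m, |∏ x ∈ s, bitSign (y x)| = 1 := fun y => by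
    rw [← bitSign_sum, abs_bitSign]
  split_ifs with hz
  · refine (abs_sub _ _).trans ?_
    rw [habs, habs]; norm_num
  · have : ∀ a : ZMod 2, ∏ x ∈ s, bitSign (Function.update y z a x) = ∏ x ∈ s, bitSign (y x) :=
      fun a => Finset.prod_congr rfl fun x hx => by
        rw [Function.update_of_ne (fun h => hz (by rwa [← h]))]
    rw [this, this]; simp

/-- Only the subspaces containing z - x see the bit z, and each such term moves by at most 2. -/
lemma abs_signSum_update_le {k m : ℕ} (hm : 1 ≤ m) (x z : Cube m) (y : Word m) :
    |signSum k x (Function.update y z 1) - signSum k x (Function.update y z 0)| ≤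
      if z = x then 0 else 2 * Fintype.card (Subspace k m) * ((2 : ℝ) ^ k - 1) / (2 ^ m - 1) := by
  classical
  have h1 : |signSum k x (Function.update y z 1) - signSum k x (Function.update y z 0)| ≤
      2 * (Finset.univ.filter fun B : Subspace k m => z ∈ puncturedCoset B x).card := by
    unfold signSum
    rw [← Finset.sum_sub_distrib]
    refine (Finset.abs_sum_le_sum_abs _ _).trans
      ((Finset.sum_le_sum fun B _ => abs_prod_bitSign_update_le _ y z).trans (le_of_eq ?_))
    rw [← Finset.sum_filter, Finset.sum_const, nsmul_eq_mul, mul_comm]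
  refine h1.trans ?_
  split_ifs with hzx
  · have : (Finset.univ.filter fun B : Subspace k m => z ∈ puncturedCoset B x) = ∅ :=
      Finset.filter_eq_empty_iff.mpr fun B _ hB => (mem_puncturedCoset.mp hB).1 hzx
    simp [this]
  · have hfil : (Finset.univ.filter fun B : Subspace k m => z ∈ puncturedCoset B x) =
        Finset.univ.filter fun B : Subspace k m => z - x ∈ B.1 :=
      Finset.filter_congr fun B _ => by rw [mem_puncturedCoset]; simp [hzx]
    have h2 := congrArg (Nat.cast (R := ℝ)) (card_subspaces_mem_mul (k := k) (sub_ne_zero.mpr hzx))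
    rw [Nat.cast_mul, Nat.cast_mul, Nat.cast_sub Nat.one_le_two_pow,
      Nat.cast_sub Nat.one_le_two_pow] at h2
    push_cast at h2
    have hm' : (1 : ℝ) < 2 ^ m := one_lt_pow₀ (by norm_num) (by omega)
    rw [hfil, le_div_iff₀ (by linarith)]
    linarith

lemma integral_signSum {k m : ℕ} (x : Cube m) (q : unitInterval) :
    ∫ y, signSum k x y ∂(bitLaw (Cube m) q) =
      Fintype.card (Subspace k m) * (1 - 2 * (q : ℝ)) ^ (2 ^ k - 1) := by
  unfold signSum
  rw [integral_finsetSum _ fun B _ => integrable_bitLaw q _]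
  simp only [integral_bitLaw_prod_bitSign, card_puncturedCoset, Finset.sum_const, nsmul_eq_mul,
    Finset.card_univ]

lemma bitLaw_real_signSum_nonpos_le {k m : ℕ} (hk : 1 ≤ k) (hkm : k ≤ m) (x : Cube m)
    (q : unitInterval) (hq0 : 0 < (q : ℝ)) (hq : (q : ℝ) < 1 / 2) :
    (bitLaw (Cube m) q).real {y | signSum k x y ≤ 0} ≤
      Real.exp (-(logOdds q * ((1 - 2 * (q : ℝ)) ^ (2 ^ k - 1)) ^ 2 * (2 ^ m - 1) /
        (16 * (2 ^ k - 1) ^ 2))) := by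
  classical
  set n : ℝ := ((Fintype.card (Subspace k m) : ℕ) : ℝ) with hn
  set w : ℝ := (1 - 2 * (q : ℝ)) ^ (2 ^ k - 1) with hw
  set L := logOdds q with hL
  have hLpos : 0 < L := logOdds_pos hq0 hq
  have hn0 : 0 < n := by rw [hn, ← gaussBinom_eq_card hkm]; exact gaussBinom_pos hkm
  have hw0 : 0 < w := pow_pos (by linarith) _
  have hK : (0 : ℝ) < 2 ^ k - 1 := by
    have : (1 : ℝ) < 2 ^ k := one_lt_pow₀ (by norm_num) (by omega)
    linarith
  have hN : (0 : ℝ) < 2 ^ m - 1 := by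
    have : (1 : ℝ) < 2 ^ m := one_lt_pow₀ (by norm_num) (by omega)
    linarith
  -- Minimizer of the exponent -l·n·w + 4·l²·n²·(2^k-1)² / ((2^m-1)·L).
  set l : ℝ := w * L * (2 ^ m - 1) / (8 * (2 ^ k - 1) ^ 2) / n with hl
  have hl0 : 0 ≤ l := by positivity
  set c : Cube m → ℝ := fun z =>
    l * if z = x then 0 else 2 * n * ((2 : ℝ) ^ k - 1) / (2 ^ m - 1) with hc
  have h1 := bitLaw_real_le_integral q {y : Word m | signSum k x y ≤ 0}
    (fun y => Real.exp (-l * signSum k x y)) (fun y => (Real.exp_pos _).le)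
    (fun y (hy : signSum k x y ≤ 0) => Real.one_le_exp (by nlinarith))
  have h2 := integral_exp_le q hq0 hq c (fun y => -l * signSum k x y) (fun z y => by
    rw [← mul_sub, abs_mul, abs_neg, abs_of_nonneg hl0]
    exact mul_le_mul_of_nonneg_left (abs_signSum_update_le (hk.trans hkm) x z y) hl0)
  have hsum : ∑ z, c z ^ 2 = (2 ^ m - 1) * (l * (2 * n * ((2 : ℝ) ^ k - 1) / (2 ^ m - 1))) ^ 2 := by
    have : ∀ z, c z ^ 2 =
        if z = x then 0 else (l * (2 * n * ((2 : ℝ) ^ k - 1) / (2 ^ m - 1))) ^ 2 := by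
      intro z; simp only [hc]; split_ifs <;> simp
    simp only [this]
    rw [← Finset.add_sum_erase _ _ (Finset.mem_univ x), if_pos rfl, zero_add,
      Finset.sum_congr rfl fun z hz => if_neg (Finset.ne_of_mem_erase hz), Finset.sum_const,
      Finset.card_erase_of_mem (Finset.mem_univ _), nsmul_eq_mul, Finset.card_univ]
    congr 1
    simp
  refine h1.trans (h2.trans (Real.exp_le_exp.mpr (le_of_eq ?_)))
  rw [hsum, integral_const_mul, integral_signSum, ← hn, ← hw, ← hL, hl]
  field_simp
  ring

/-- One iteration of the decoder for `RM(m, k + 1)` corrects all errors with high probability. -/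
lemma bitLaw_real_rpaIteration_ne_zero_le {k m : ℕ} (hk : 1 ≤ k) (hkm : k ≤ m)
    (e : ∀ B : Subspace k m, CosetLabelling B) (D : Word (m - k) → Word (m - k))
    (hD : IsMLDecoder (reedMuller (m - k) 1) D) (q : unitInterval)
    (hq0 : 0 < (q : ℝ)) (hq : (q : ℝ) < 1 / 2) (ε : ℝ) (hε0 : 0 < ε)
    (hε : 2 * ε < (1 - 2 * (q : ℝ)) ^ (2 ^ k)) :
    (bitLaw (Cube m) q).real {y | rpaIteration e D y ≠ 0} ≤
      (gaussBinom k m * (2 * 2 ^ m) + 2 ^ m) *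
        Real.exp (-(logOdds q * (2 : ℝ) ^ (-2 * (k : ℤ) - 2) * 2 ^ m * ε ^ 2)) := by
  classical
  set E := Real.exp (-(logOdds q * (2 : ℝ) ^ (-2 * (k : ℤ) - 2) * 2 ^ m * ε ^ 2)) with hE
  set u : ℝ := 1 - 2 * (q : ℝ) with hu
  have hu0 : 0 < u := by linarith
  have hu1 : u < 1 := by linarith
  have hLpos : 0 < logOdds q := logOdds_pos hq0 hq
  have hzpow : (2 : ℝ) ^ (-2 * (k : ℤ) - 2) = 1 / (4 * (2 ^ k) ^ 2) := by
    rw [show -2 * (k : ℤ) - 2 = -((2 * k + 2 : ℕ) : ℤ) by push_cast; ring, zpow_neg, zpow_natCast,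
      pow_add, mul_comm 2 k, pow_mul]
    norm_num [mul_comm]
  have hK2 : (2 : ℝ) ≤ 2 ^ k := by
    calc (2 : ℝ) = 2 ^ 1 := by norm_num
      _ ≤ 2 ^ k := pow_le_pow_right₀ (by norm_num) hk
  have hNK : (2 : ℝ) ^ k ≤ 2 ^ m := pow_le_pow_right₀ (by norm_num) hkm
  have hsub : {y | rpaIteration e D y ≠ 0} ⊆
      (⋃ B ∈ (Finset.univ : Finset (Subspace k m)), projWord B (e B) ⁻¹' {y' | D y' ≠ 0}) ∪
        ⋃ x ∈ (Finset.univ : Finset (Cube m)), {y | signSum k x y ≤ 0} := by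
    intro y hy
    by_contra hcon
    simp only [Set.mem_union, Set.mem_iUnion, not_or, not_exists] at hcon
    exact hy (rpaIteration_eq_zero e D y
      (fun B => not_not.mp (hcon.1 B (Finset.mem_univ _)))
      (fun x => not_le.mp (hcon.2 x (Finset.mem_univ _))))
  have hdec : ∀ B : Subspace k m,
      (bitLaw (Cube m) q).real (projWord B (e B) ⁻¹' {y' | D y' ≠ 0}) ≤ 2 * 2 ^ m * E := by
    intro B
    have hpos : 0 < u ^ 2 ^ k := by positivity
    have hlt : u ^ 2 ^ k < 1 := pow_lt_one₀ hu0.le hu1 (by positivity)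
    have hval : 1 - 2 * (crossoverI q k : ℝ) = u ^ 2 ^ k := one_sub_two_mul_crossover q k
    rw [← map_measureReal_apply (measurable_of_finite _) (Set.toFinite _).measurableSet,
      map_projWord_bitLaw]
    refine (bitLaw_real_decoder_ne_zero_le D hD (crossoverI q k) (by linarith) (by linarith)).trans
      ?_
    rw [hval]
    have hpow : (2 : ℝ) ^ (m - k) = 2 ^ m / 2 ^ k := by
      rw [pow_sub₀ _ (by norm_num) hkm]; rfl
    have hle : (2 : ℝ) ^ (m - k) ≤ 2 ^ m := pow_le_pow_right₀ (by norm_num) (Nat.sub_le _ _)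
    have hexp : Real.exp (2 ^ (m - k) / 4 * Real.log (1 - (u ^ 2 ^ k) ^ 2)) ≤ E := by
      refine Real.exp_le_exp.mpr ?_
      have h1 := log_odds_mul_le hu0 hu1 (K := 2 ^ k) Nat.one_le_two_pow
      have hodds : (1 + u) / (1 - u) = (1 - q) / q := by
        rw [hu]; field_simp; ring
      rw [hodds] at h1
      change (u ^ 2 ^ k) ^ 2 / 4 * logOdds q ≤ _ at h1
      push_cast at h1
      -- This is where the decoding errors use ε below half of the projected bias 1 - 2·p^(k), taken
      -- from q.
      have h2 : ε ^ 2 ≤ (u ^ 2 ^ k) ^ 2 / 4 := by nlinarith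
      have h3 : ε ^ 2 * logOdds q ≤ 2 ^ k * -Real.log (1 - (u ^ 2 ^ k) ^ 2) :=
        (mul_le_mul_of_nonneg_right h2 hLpos.le).trans h1
      have h4 : ε ^ 2 * logOdds q * (2 ^ m / (4 * (2 ^ k) ^ 2)) ≤
          2 ^ k * -Real.log (1 - (u ^ 2 ^ k) ^ 2) * (2 ^ m / (4 * (2 ^ k) ^ 2)) :=
        mul_le_mul_of_nonneg_right h3 (by positivity)
      have h5 : (2 : ℝ) ^ k * -Real.log (1 - (u ^ 2 ^ k) ^ 2) * (2 ^ m / (4 * (2 ^ k) ^ 2)) =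
          -(2 ^ m / 2 ^ k / 4 * Real.log (1 - (u ^ 2 ^ k) ^ 2)) := by
        field_simp
      have h6 : logOdds q * (1 / (4 * (2 ^ k) ^ 2)) * 2 ^ m * ε ^ 2 =
          ε ^ 2 * logOdds q * (2 ^ m / (4 * (2 ^ k) ^ 2)) := by ring
      rw [hpow, hzpow, h6]
      linarith
    exact mul_le_mul (mul_le_mul_of_nonneg_left hle (by norm_num)) hexp (Real.exp_pos _).le
      (by positivity)
  have hagg : ∀ x : Cube m, (bitLaw (Cube m) q).real {y | signSum k x y ≤ 0} ≤ E := by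
    intro x
    refine (bitLaw_real_signSum_nonpos_le hk hkm x q hq0 hq).trans (Real.exp_le_exp.mpr ?_)
    rw [← hu]
    -- The punctured coset has one point fewer, which only increases the power of u < 1.
    have hw : 4 * ε ^ 2 ≤ (u ^ (2 ^ k - 1)) ^ 2 := by
      have : u ^ 2 ^ k ≤ u ^ (2 ^ k - 1) := pow_le_pow_of_le_one hu0.le hu1.le (Nat.sub_le _ _)
      nlinarith
    have hfrac : (2 : ℝ) ^ m / (16 * (2 ^ k) ^ 2) ≤ (2 ^ m - 1) / (16 * (2 ^ k - 1) ^ 2) := by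
      have hpos : (0 : ℝ) < (2 ^ k - 1) ^ 2 := pow_pos (by linarith) 2
      rw [div_le_div_iff₀ (by positivity) (by linarith)]
      nlinarith
    have h1 : logOdds q * (4 * ε ^ 2) * (2 ^ m / (16 * (2 ^ k) ^ 2)) ≤
        logOdds q * (u ^ (2 ^ k - 1)) ^ 2 * ((2 ^ m - 1) / (16 * (2 ^ k - 1) ^ 2)) := by
      refine mul_le_mul (mul_le_mul_of_nonneg_left hw hLpos.le) hfrac (by positivity) ?_
      positivity
    have h2 : logOdds q * (4 * ε ^ 2) * ((2 : ℝ) ^ m / (16 * (2 ^ k) ^ 2)) =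
        logOdds q * (1 / (4 * (2 ^ k) ^ 2)) * 2 ^ m * ε ^ 2 := by
      field_simp; norm_num
    rw [hzpow, ← h2, mul_div_assoc]
    exact neg_le_neg h1
  refine (measureReal_mono hsub (measure_ne_top _ _)).trans ((measureReal_union_le _ _).trans ?_)
  rw [add_mul, mul_assoc]
  refine add_le_add ((measureReal_biUnion_finset_le _ _).trans ?_)
    ((measureReal_biUnion_finset_le _ _).trans ?_)
  · refine (Finset.sum_le_card_nsmul _ _ _ fun B _ => hdec B).trans (le_of_eq ?_)
    rw [nsmul_eq_mul, Finset.card_univ, gaussBinom_eq_card hkm]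
  · refine (Finset.sum_le_card_nsmul _ _ _ fun x _ => hagg x).trans (le_of_eq ?_)
    simp [nsmul_eq_mul]

end RPA

end

/-! ### Transfer to the node of the tree. -/

theorem theorem6 (m r k : ℕ) (hk : 1 ≤ k) (hkr : k + 1 ≤ r) (hdvd : k ∣ r - 1) (hrm : r ≤ m)
    (p : unitInterval) (hp0 : 0 < (p : ℝ)) (hp : (p : ℝ) < 1 / 2)
    (ε : ℝ) (hε0 : 0 < ε) (hε : ε < RPA.etaBar (RPA.crossover p (r - 1)))
    (path : RPA.ProjPath k m ((r - 1 - k) / k) (m - (r - 1 - k)))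
    (e : ∀ B : RPA.Subspace k (m - (r - 1 - k)), RPA.CosetLabelling B)
    (D : RPA.Word (m - (r - 1 - k) - k) → RPA.Word (m - (r - 1 - k) - k))
    (hD : RPA.IsMLDecoder (RPA.reedMuller (m - (r - 1 - k) - k) 1) D) :
    1 - (RPA.receivedLaw m p).real {y | RPA.rpaIteration e D (path.project y) = 0} ≤
      32 * RPA.gaussBinom k m * RPA.blockLength m (r - k - 1) ^ 2 *
        Real.exp (-(Real.log ((1 - RPA.crossover p (r - k - 1)) / RPA.crossover p (r - k - 1)) *
          (2 : ℝ) ^ (-2 * (k : ℤ) - 2) * RPA.blockLength m (r - k - 1) * ε ^ 2)) := by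

  revert path e D hD
  generalize hd : r - 1 - k = d
  intro path e D hD
  have hdeq : r - k - 1 = d := by omega
  -- Divisibility makes the level an exact quotient, so the path lowers the dimension by exactly d
  -- and the bias at its end is p^(d).
  have hkd : k * (d / k) = d := Nat.mul_div_cancel' (hd ▸ Nat.dvd_sub hdvd dvd_rfl)
  set q := RPA.crossoverI p d with hq
  have hqc : (q : ℝ) = RPA.crossover p d := rfl
  have hu := RPA.one_sub_two_mul_crossover p d
  rw [← hqc] at hu
  have hp1 : 0 < 1 - 2 * (p : ℝ) := by linarith
  have hu0 : 0 < 1 - 2 * (q : ℝ) := by rw [hu]; positivity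
  have hu1 : 1 - 2 * (q : ℝ) < 1 := by
    rw [hu]; exact pow_lt_one₀ hp1.le (by linarith) (by positivity)
  -- One more projection leads from level d to d + k = r - 1, so the right side is 1 - 2·p^(r-1).
  have hε' : 2 * ε < (1 - 2 * (q : ℝ)) ^ (2 ^ k) := by
    rw [hu, ← pow_mul, ← pow_add, show d + k = r - 1 by omega]
    have h := RPA.one_sub_two_mul_crossover p (r - 1)
    unfold RPA.etaBar at hε
    linarith
  have hkM : k ≤ m - d := by omega
  have hlaw : (RPA.receivedLaw m p).map path.project = RPA.bitLaw (RPA.Cube (m - d)) q := by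
    have h := RPA.map_project_bitLaw path p
    rwa [hkd] at h
  have hprob : IsProbabilityMeasure (RPA.receivedLaw m p) :=
    inferInstanceAs (IsProbabilityMeasure (RPA.bitLaw (RPA.Cube m) p))
  have hmain := RPA.bitLaw_real_rpaIteration_ne_zero_le hk hkM e D hD q (by linarith) (by linarith)
    ε hε0 hε'
  rw [← hlaw, map_measureReal_apply (measurable_of_finite _) (Set.toFinite _).measurableSet]
    at hmain
  have hcompl : 1 - (RPA.receivedLaw m p).real {y | RPA.rpaIteration e D (path.project y) = 0} =
      (RPA.receivedLaw m p).real (path.project ⁻¹' {y | RPA.rpaIteration e D y ≠ 0}) :=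
    (probReal_compl_eq_one_sub (Set.toFinite _).measurableSet).symm
  have hlen : RPA.blockLength m d = (2 : ℝ) ^ (m - d) := by
    rw [RPA.blockLength, pow_sub₀ _ (by norm_num) (by omega)]; rfl
  have hG1 : 1 ≤ RPA.gaussBinom k (m - d) := by
    have h := RPA.gaussBinom_pos hkM
    rw [RPA.gaussBinom_eq_card hkM] at h ⊢
    exact_mod_cast h
  have hG := RPA.gaussBinom_mono hkM (Nat.sub_le m d)
  rw [hcompl, hdeq, hlen, ← hqc]
  refine hmain.trans (mul_le_mul_of_nonneg_right ?_ (Real.exp_pos _).le)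
  have hN : (1 : ℝ) ≤ 2 ^ (m - d) := one_le_pow₀ (by norm_num)
  generalize (2 : ℝ) ^ (m - d) = N at hN ⊢
  generalize RPA.gaussBinom k (m - d) = g at hG1 hG ⊢
  generalize RPA.gaussBinom k m = G at hG ⊢
  -- The union bound has 2gN + N ≤ 3gN terms, so the prefactor 32·G·N² leaves ample room.
  have h1 : g * N ≤ G * N ^ 2 := mul_le_mul hG (by nlinarith) (by linarith) (by linarith)
  have h2 : 1 * N ≤ g * N := mul_le_mul_of_nonneg_right hG1 (by linarith)
  nlinarith
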